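/- All graphs are finite and simple. A burning process of a connected graph $G$ starts with all vertices unburned. In each round $r\ge 1$ one chooses a vertex $x_r$ that is not burned at the end of round $r-1$ (the source of round $r$), and burns $x_r$ together with all unburned vertices that are adjacent to some vertex burned by the end of round $r-1$; burned vertices remain burned. The process terminates when all vertices are burned. If it terminates in $k$ rounds, $(x_1,\dots,x_k)$ is a burning sequence for $G$ of length $k$. The burning number $b(G)$ is the minimum length of a burning sequence for $G$. Theorem. Let $T$ be a tree of order $n$ with $n_2$ vertices of degree $2$. Then $$b(T)\le \left\lceil \left(n+n_2-\left\lceil\sqrt{n+n_2+0.25}-1.5\right\rceil\right)^{\frac12}\right\rceil.$$ -/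

import Mathlib

/-- The set of vertices of `G` that are burned at the end of round `r`, where `s[r]` is the source
of round `r + 1` (so a list lists the sources of rounds `1, 2, …`). In round `r + 1` the source of
that round is burned together with every neighbour of a vertex that was burned by the end of
round `r`; burned vertices remain burned. -/
def SimpleGraph.burnedAfter {V : Type*} (G : SimpleGraph V) (s : List V) : ℕ → Set V
  | 0 => ∅
  | r + 1 => {v | v ∈ G.burnedAfter s r ∨ s[r]? = some v ∨ ∃ u ∈ G.burnedAfter s r, G.Adj u v}

/-- `s` is a burning sequence for `G`: every source is still unburned at the beginning of the round
in which it is chosen, and all vertices are burned at the end of the last round. (As every round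
has an unburned source, not all vertices are burned before the last round.) -/
def SimpleGraph.IsBurningSequence {V : Type*} (G : SimpleGraph V) (s : List V) : Prop :=
  (∀ (r : ℕ) (hr : r < s.length), s[r] ∉ G.burnedAfter s r) ∧
    G.burnedAfter s s.length = Set.univ

/-- The burning number of `G`: the minimum length of a burning sequence for `G`. -/
noncomputable def SimpleGraph.burningNumber {V : Type*} (G : SimpleGraph V) : ℕ :=
  sInf {k : ℕ | ∃ s : List V, G.IsBurningSequence s ∧ s.length = k}

theorem SimpleGraph.burnedAfter_append {V : Type*} (G : SimpleGraph V) (s t : List V) :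
    ∀ r : ℕ, r ≤ s.length → G.burnedAfter (s ++ t) r = G.burnedAfter s r
  | 0, _ => rfl
  | r + 1, h => by
    have ih := G.burnedAfter_append s t r (by omega)
    have h' : (s ++ t)[r]? = s[r]? := List.getElem?_append_left (by omega)
    simp only [SimpleGraph.burnedAfter, ih, h']

/-- A finite graph has a burning sequence, so the minimum defining the burning number is
attained. -/
theorem SimpleGraph.exists_isBurningSequence_length_eq {V : Type*} [Finite V]
    (G : SimpleGraph V) :
    ∃ s : List V, G.IsBurningSequence s ∧ s.length = G.burningNumber := by
  have key : ∀ (n : ℕ) (s : List V),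
      (∀ (r : ℕ) (hr : r < s.length), s[r] ∉ G.burnedAfter s r) →
      (G.burnedAfter s s.length)ᶜ.ncard ≤ n → ∃ t : List V, G.IsBurningSequence t := by
    intro n
    induction n with
    | zero =>
      intro s hs hc
      refine ⟨s, hs, ?_⟩
      have h0 := (Set.ncard_eq_zero (Set.toFinite _)).1 (Nat.le_zero.1 hc)
      simpa using h0
    | succ n ih =>
      intro s hs hc
      by_cases hu : G.burnedAfter s s.length = Set.univ
      · exact ⟨s, hs, hu⟩
      obtain ⟨x, hx⟩ := (Set.ne_univ_iff_exists_notMem _).1 hu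
      refine ih (s ++ [x]) ?_ ?_
      · intro r hr
        have hr' : r ≤ s.length := by
          simp only [List.length_append, List.length_singleton] at hr
          omega
        rw [G.burnedAfter_append s [x] r hr']
        rcases hr'.lt_or_eq with h | h
        · rw [List.getElem_append_left h]
          exact hs r h
        · subst h
          simpa using hx
      · have hlt : (G.burnedAfter (s ++ [x]) (s ++ [x]).length)ᶜ.ncard <
            (G.burnedAfter s s.length)ᶜ.ncard := by
          apply Set.ncard_lt_ncard _ (Set.toFinite _)
          rw [compl_lt_compl_iff_lt, Set.ssubset_iff_exists]
          simp only [List.length_append, List.length_singleton, SimpleGraph.burnedAfter,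
            G.burnedAfter_append s [x] s.length le_rfl]
          exact ⟨fun v hv => Or.inl hv, x, Or.inr (Or.inl (by simp)), hx⟩
        omega
  obtain ⟨t, ht⟩ := key _ [] (by simp) le_rfl
  exact Nat.sInf_mem (s := {k : ℕ | ∃ s : List V, G.IsBurningSequence s ∧ s.length = k})
    ⟨t.length, t, ht, rfl⟩

namespace SimpleGraph

variable {V : Type*} {G : SimpleGraph V}

/-! ### Burning by covering with balls -/

/-! Burning in `k` rounds amounts to covering by balls of radii `0, ..., k - 1`. It suffices to
cover the set `A` of non-leaves with all positive radii lowered by one, since every leaf then lies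
one step further out. Degree counting gives `2|A| + 2 ≤ n + n₂`. Cutting off a deepest part of `A`
with a ball of radius `r` removes at least `r + 1` vertices, and the last and largest ball, of
radius `R`, covers any remainder of at most `2R + 1` vertices (`exists_cover`). Hence `n + n₂ < k (k
+ 1)` suffices, and the stated ceiling satisfies this. -/

theorem burnedAfter_mono (s : List V) : Monotone (G.burnedAfter s) :=
  monotone_nat_of_le_succ fun _ _ hv => Or.inl hv

theorem Walk.mem_burnedAfter {s : List V} {u v : V} (p : G.Walk u v) {r : ℕ}
    (hu : u ∈ G.burnedAfter s r) : v ∈ G.burnedAfter s (r + p.length) := by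
  induction p generalizing r with
  | nil => simpa using hu
  | cons h p ih =>
    have := ih (r := r + 1) (Or.inr (Or.inr ⟨_, hu, h⟩))
    rw [Walk.length_cons]
    rwa [Nat.add_assoc, Nat.add_comm 1] at this

theorem burningNumber_le_of_isBurningSequence {s : List V} (hs : G.IsBurningSequence s) :
    G.burningNumber ≤ s.length :=
  Nat.sInf_le ⟨s, hs, rfl⟩

/-- If, greedily, one tries to use `c r` as the source of round `r + 1`, then either everything
burns within `r` rounds, or `c i` is burned by the end of round `i + 1` for every `i < r`. -/
theorem exists_sources (G : SimpleGraph V) (c : ℕ → V) (r : ℕ) :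
    G.burningNumber ≤ r ∨ ∃ s : List V, s.length = r ∧
      (∀ (i : ℕ) (hi : i < s.length), s[i] ∉ G.burnedAfter s i) ∧
      ∀ i < r, c i ∈ G.burnedAfter s (i + 1) := by
  induction r with
  | zero => exact Or.inr ⟨[], rfl, by simp, by simp⟩
  | succ r ih =>
    obtain h | ⟨s, hl, hs, hc⟩ := ih
    · exact Or.inl (by omega)
    by_cases hu : G.burnedAfter s s.length = Set.univ
    · have := burningNumber_le_of_isBurningSequence ⟨hs, hu⟩
      exact Or.inl (by omega)
    have hx : ∃ x ∉ G.burnedAfter s r, c r = x ∨ c r ∈ G.burnedAfter s r := by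
      by_cases h : c r ∈ G.burnedAfter s r
      · obtain ⟨x, hx⟩ := (Set.ne_univ_iff_exists_notMem _).1 hu
        exact ⟨x, hl ▸ hx, Or.inr h⟩
      · exact ⟨c r, h, Or.inl rfl⟩
    obtain ⟨x, hx, hcx⟩ := hx
    refine Or.inr ⟨s ++ [x], by simp [hl], ?_, ?_⟩
    · intro i hi
      have hi' : i ≤ s.length := by
        simp only [List.length_append, List.length_singleton] at hi
        omega
      rw [G.burnedAfter_append s [x] i hi']
      rcases hi'.lt_or_eq with h | h
      · rw [List.getElem_append_left h]
        exact hs i h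
      · subst h
        simpa [hl] using hx
    · intro i hi
      rcases (Nat.lt_succ_iff.1 hi).lt_or_eq with h | rfl
      · rw [G.burnedAfter_append s [x] (i + 1) (by omega)]
        exact hc i h
      · obtain h | h := hcx
        · refine Or.inr (Or.inl ?_)
          rw [h, ← hl]
          simp
        · refine Or.inl ?_
          rwa [G.burnedAfter_append s [x] i (by omega)]

/-- Fire at `c i` by round `i + 1` has `k - 1 - i` rounds left to spread. The balls may overlap,
because `exists_sources` replaces a centre that is already burned. -/
theorem Connected.burningNumber_le_of_cover (hG : G.Connected) {k : ℕ} (c : ℕ → V)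
    (hc : ∀ v, ∃ i < k, i + G.dist (c i) v + 1 ≤ k) : G.burningNumber ≤ k := by
  obtain h | ⟨s, hl, hs, hcs⟩ := G.exists_sources c k
  · exact h
  · rw [← hl]
    refine burningNumber_le_of_isBurningSequence ⟨hs, Set.eq_univ_of_forall fun v => ?_⟩
    obtain ⟨i, hi, hv⟩ := hc v
    obtain ⟨p, hp⟩ := hG.exists_walk_length_eq_dist (c i) v
    exact burnedAfter_mono s (by omega) (p.mem_burnedAfter (hcs i hi))

/-! ### Geodesically closed sets -/

theorem Connected.exists_adj_dist_succ (hG : G.Connected) {x w : V} (hw : w ≠ x) :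
    ∃ w', G.Adj w' w ∧ G.dist x w' + 1 = G.dist x w := by
  obtain ⟨p, hp⟩ := hG.exists_walk_length_eq_dist w x
  cases p with
  | nil => exact absurd rfl hw
  | @cons _ w' _ h p =>
    refine ⟨w', h.symm, ?_⟩
    have h1 : G.dist w' x ≤ p.length := dist_le p
    have h2 : G.dist w x ≤ G.dist w w' + G.dist w' x := hG.dist_triangle
    rw [dist_eq_one_iff_adj.2 h] at h2
    rw [Walk.length_cons] at hp
    rw [dist_comm, G.dist_comm (u := x)]
    omega

/-- `A` contains `x`, and some geodesic of `G` from `x` to each of its members. -/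
def IsGeodesicallyClosed (G : SimpleGraph V) (x : V) (A : Finset V) : Prop :=
  x ∈ A ∧ ∀ w ∈ A, w ≠ x → ∃ w' ∈ A, G.Adj w' w ∧ G.dist x w' + 1 = G.dist x w

/-- The members `w` of `A` such that `v` lies on a geodesic from `x` to `w`. -/
noncomputable def beyond (G : SimpleGraph V) (x : V) (A : Finset V) (v : V) : Finset V :=
  A.filter fun w => G.dist x w = G.dist x v + G.dist v w

namespace IsGeodesicallyClosed

variable {x : V} {A : Finset V}

/-- Climb `r` steps from `u` towards `x`; each step adds the new vertex to the set beyond. -/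
theorem exists_ancestor (hA : G.IsGeodesicallyClosed x A) (hG : G.Connected) {u : V}
    (hu : u ∈ A) (r : ℕ) (hr : r ≤ G.dist x u) :
    ∃ v ∈ A, G.dist x v + r = G.dist x u ∧ r + 1 ≤ (G.beyond x A v).card := by
  induction r with
  | zero => exact ⟨u, hu, rfl, Finset.card_pos.2 ⟨u, by simp [beyond, hu]⟩⟩
  | succ r ih =>
    obtain ⟨v, hv, hd, hc⟩ := ih (by omega)
    have hvx : v ≠ x := by
      rintro rfl
      rw [dist_self] at hd
      omega
    obtain ⟨v', hv', hadj, hd'⟩ := hA.2 v hv hvx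
    refine ⟨v', hv', by omega, ?_⟩
    refine lt_of_le_of_lt hc (Finset.card_lt_card ?_)
    rw [Finset.ssubset_iff_of_subset]
    · refine ⟨v', by simp [beyond, hv'], fun h => ?_⟩
      have := (Finset.mem_filter.1 h).2
      omega
    · intro w hw
      obtain ⟨hw, hd⟩ := Finset.mem_filter.1 hw
      refine Finset.mem_filter.2 ⟨hw, le_antisymm hG.dist_triangle ?_⟩
      have : G.dist v' w ≤ G.dist v' v + G.dist v w := hG.dist_triangle
      rw [dist_eq_one_iff_adj.2 hadj] at this
      omega

theorem sdiff_beyond [DecidableEq V] (hA : G.IsGeodesicallyClosed x A) (hG : G.Connected)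
    {v : V} (hv : v ≠ x) : G.IsGeodesicallyClosed x (A \ G.beyond x A v) := by
  have hpos := hG.pos_dist_of_ne hv.symm
  refine ⟨Finset.mem_sdiff.2 ⟨hA.1, fun h => ?_⟩, fun w hw hwx => ?_⟩
  · have := (Finset.mem_filter.1 h).2
    rw [dist_self] at this
    omega
  · obtain ⟨hwA, hw⟩ := Finset.mem_sdiff.1 hw
    obtain ⟨w', hw', hadj, hd⟩ := hA.2 w hwA hwx
    refine ⟨w', Finset.mem_sdiff.2 ⟨hw', fun h => hw ?_⟩, hadj, hd⟩
    have h' := (Finset.mem_filter.1 h).2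
    refine Finset.mem_filter.2 ⟨hwA, le_antisymm hG.dist_triangle ?_⟩
    have : G.dist v w ≤ G.dist v w' + G.dist w' w := hG.dist_triangle
    rw [dist_eq_one_iff_adj.2 hadj] at this
    omega

/-- A geodesically closed set lies in a ball of radius `r`, or loses at least `r + 1` vertices of
such a ball and stays geodesically closed. -/
theorem exists_ball [DecidableEq V] (hA : G.IsGeodesicallyClosed x A) (hG : G.Connected)
    (r : ℕ) : (∀ w ∈ A, G.dist x w ≤ r) ∨ ∃ v p, ∃ B, G.IsGeodesicallyClosed x B ∧
      B.card + (r + 1) ≤ A.card ∧ (∀ w ∈ A, w ∈ B ∨ G.dist v w ≤ r) ∧ p ∈ B ∧ G.Adj v p := by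
  obtain ⟨u, hu, hmax⟩ := A.exists_max_image (G.dist x) ⟨x, hA.1⟩
  by_cases hr : G.dist x u ≤ r
  · exact Or.inl fun w hw => (hmax w hw).trans hr
  obtain ⟨v, hv, hd, hc⟩ := hA.exists_ancestor hG hu r (by omega)
  have hvx : v ≠ x := by
    rintro rfl
    rw [dist_self] at hd
    omega
  obtain ⟨p, hp, hadj, hdp⟩ := hA.2 v hv hvx
  refine Or.inr ⟨v, p, A \ G.beyond x A v, hA.sdiff_beyond hG hvx, ?_, ?_,
    ?_, hadj.symm⟩
  · have hsub : G.beyond x A v ⊆ A := Finset.filter_subset _ _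
    have := Finset.card_sdiff_add_card_eq_card hsub
    omega
  · intro w hw
    by_cases h : w ∈ G.beyond x A v
    · have h1 := (Finset.mem_filter.1 h).2
      have h2 := hmax w hw
      exact Or.inr (by omega)
    · exact Or.inl (Finset.mem_sdiff.2 ⟨hw, h⟩)
  · refine Finset.mem_sdiff.2 ⟨hp, fun h => ?_⟩
    have := (Finset.mem_filter.1 h).2
    omega

theorem induce_connected (hA : G.IsGeodesicallyClosed x A) :
    (G.induce (A : Set V)).Connected := by
  have key : ∀ (d : ℕ) (w : V) (hw : w ∈ A), G.dist x w = d →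
      (G.induce (A : Set V)).Reachable ⟨x, hA.1⟩ ⟨w, hw⟩ := by
    intro d
    induction d with
    | zero =>
      intro w hw hd
      by_cases h : w = x
      · subst h
        exact Reachable.refl _
      · obtain ⟨w', -, -, h'⟩ := hA.2 w hw h
        omega
    | succ d ih =>
      intro w hw hd
      have hwx : w ≠ x := by
        rintro rfl
        rw [dist_self] at hd
        omega
      obtain ⟨w', hw', hadj, h'⟩ := hA.2 w hw hwx
      refine (ih w' hw' (by omega)).trans (Adj.reachable ?_)
      exact hadj
  exact (connected_iff_exists_forall_reachable _).2
    ⟨⟨x, hA.1⟩, fun w => key _ w.1 w.2 rfl⟩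

theorem dist_lt_card (hA : G.IsGeodesicallyClosed x A) {p w : V} (hp : p ∈ A) (hw : w ∈ A) :
    G.dist p w < A.card := by
  classical
  obtain ⟨q, hq⟩ := (hA.induce_connected ⟨p, hp⟩ ⟨w, hw⟩).exists_isPath
  have h1 := hq.length_lt
  have h2 := dist_le (q.map (Embedding.induce (A : Set V)).toHom)
  rw [Walk.length_map] at h2
  refine h2.trans_lt ?_
  simpa using h1

/-- Removing a ball around `v` leaves at most `R` vertices, connected and containing a neighbour of
`v`, so the same ball reaches them too. -/
theorem exists_center (hA : G.IsGeodesicallyClosed x A) (hG : G.Connected) {R : ℕ}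
    (hc : A.card ≤ 2 * R + 1) : ∃ z, ∀ w ∈ A, G.dist z w ≤ R := by
  classical
  obtain h | ⟨v, p, B, hB, hcard, hcov, hp, hadj⟩ := hA.exists_ball hG R
  · exact ⟨x, h⟩
  · refine ⟨v, fun w hw => (hcov w hw).elim (fun h => ?_) id⟩
    have h1 := hB.dist_lt_card hp h
    have h2 : G.dist v w ≤ G.dist v p + G.dist p w := hG.dist_triangle
    rw [dist_eq_one_iff_adj.2 hadj] at h2
    omega

/-- Radii `j - 1, ..., 0` remove at least `j + ... + 1` vertices; `exists_center` handles the rest.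
-/
theorem exists_cover (hG : G.Connected) {R : ℕ} (j : ℕ) :
    ∀ {A : Finset V}, G.IsGeodesicallyClosed x A → 2 * A.card ≤ j * (j + 1) + 2 * (2 * R + 1) →
      ∃ (c : ℕ → V) (z : V), ∀ w ∈ A, (∃ i < j, G.dist (c i) w ≤ i) ∨ G.dist z w ≤ R := by
  classical
  induction j with
  | zero =>
    intro A hA hc
    obtain ⟨z, hz⟩ := hA.exists_center hG (R := R) (by omega)
    exact ⟨fun _ => z, z, fun w hw => Or.inr (hz w hw)⟩
  | succ j ih =>
    intro A hA hc
    obtain h | ⟨v, -, B, hB, hcard, hcov, -, -⟩ := hA.exists_ball hG j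
    · exact ⟨fun _ => x, x, fun w hw => Or.inl ⟨j, by omega, h w hw⟩⟩
    · obtain ⟨c, z, hcz⟩ := ih hB (by nlinarith)
      refine ⟨Function.update c j v, z, fun w hw => ?_⟩
      obtain h | h := hcov w hw
      · obtain ⟨i, hi, h⟩ | h := hcz w h
        · refine Or.inl ⟨i, by omega, ?_⟩
          rwa [Function.update_of_ne hi.ne]
        · exact Or.inr h
      · exact Or.inl ⟨j, by omega, by rwa [Function.update_self]⟩

end IsGeodesicallyClosed

/-! ### Trees -/

section Trees

variable [Fintype V] [DecidableRel G.Adj]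

theorem two_le_degree {u v w : V} (hu : G.Adj v u) (hw : G.Adj v w) (huw : u ≠ w) :
    2 ≤ G.degree v := by
  classical
  rw [← card_neighborFinset_eq_degree, ← Finset.card_pair huw]
  exact Finset.card_le_card fun y hy => by
    rcases Finset.mem_insert.1 hy with rfl | hy
    · simpa using hu
    · rw [Finset.mem_singleton.1 hy]
      simpa using hw

theorem Connected.exists_adj_two_le_degree (hG : G.Connected) {x w : V} (hx : 2 ≤ G.degree x)
    (hw : w ≠ x) : ∃ w', 2 ≤ G.degree w' ∧ G.Adj w' w ∧ G.dist x w' + 1 = G.dist x w := by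
  obtain ⟨w', hadj, hd⟩ := hG.exists_adj_dist_succ hw
  refine ⟨w', ?_, hadj, hd⟩
  by_cases h : w' = x
  · rwa [h]
  · obtain ⟨w'', hadj', hd'⟩ := hG.exists_adj_dist_succ h
    refine two_le_degree hadj'.symm hadj ?_
    rintro rfl
    omega

theorem Connected.isGeodesicallyClosed_two_le_degree (hG : G.Connected) {x : V}
    (hx : 2 ≤ G.degree x) :
    G.IsGeodesicallyClosed x (Finset.univ.filter fun v => 2 ≤ G.degree v) := by
  refine ⟨by simpa using hx, fun w _ hwx => ?_⟩
  obtain ⟨w', hw', h⟩ := hG.exists_adj_two_le_degree hx hwx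
  exact ⟨w', by simpa using hw', h⟩

theorem IsTree.sum_degree (hG : G.IsTree) : ∑ v, G.degree v + 2 = 2 * Fintype.card V := by
  classical
  have := hG.card_edgeFinset
  have := G.sum_degrees_eq_twice_card_edges
  omega

theorem IsTree.card_two_le_degree (hG : G.IsTree) (hV : 1 < Fintype.card V) :
    2 * (Finset.univ.filter fun v => 2 ≤ G.degree v).card + 2 ≤
      Fintype.card V + (Finset.univ.filter fun v => G.degree v = 2).card := by
  have : Nontrivial V := Fintype.one_lt_card_iff_nontrivial.1 hV
  -- Holds vertex by vertex, with equality at degrees 1, 2 and 3.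
  have h : ∑ v : V, (2 + 2 * if 2 ≤ G.degree v then 1 else 0) ≤
      ∑ v : V, (1 + (if G.degree v = 2 then 1 else 0) + G.degree v) := by
    refine Finset.sum_le_sum fun v _ => ?_
    have := hG.connected.preconnected.degree_pos_of_nontrivial v
    split_ifs <;> omega
  simp only [Finset.sum_add_distrib, ← Finset.mul_sum, ← Finset.card_filter, Finset.sum_const,
    Finset.card_univ, smul_eq_mul] at h
  have := hG.sum_degree
  omega

theorem IsTree.burningNumber_le (hG : G.IsTree) {k : ℕ}
    (hk : Fintype.card V + (Finset.univ.filter fun v => G.degree v = 2).card + 1 ≤ k * (k + 1)) :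
    G.burningNumber ≤ k := by
  have hconn := hG.connected
  have hne := hconn.nonempty
  by_cases hx : ∃ x, 2 ≤ G.degree x
  · obtain ⟨x, hx⟩ := hx
    set A := Finset.univ.filter fun v => 2 ≤ G.degree v with hAdef
    have hA : G.IsGeodesicallyClosed x A := hconn.isGeodesicallyClosed_two_le_degree hx
    have hA0 : 0 < A.card := Finset.card_pos.2 ⟨x, hA.1⟩
    have hV : 1 < Fintype.card V := lt_of_lt_of_le hx (G.degree_lt_card_verts x).le
    have hcard := hG.card_two_le_degree hV
    rw [← hAdef] at hcard
    obtain ⟨m, rfl⟩ : ∃ m, k = m + 2 := ⟨k - 2, by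
      have : 1 < k := by
        by_contra h
        interval_cases k <;> omega
      omega⟩
    -- Parity gains the one unit that the size bound on `A` would otherwise miss.
    have hpar : Even ((m + 2) * (m + 2 + 1)) := Nat.even_mul_succ_self _
    obtain ⟨q, hq⟩ := hpar
    obtain ⟨c, z, hcz⟩ := IsGeodesicallyClosed.exists_cover (R := m) hconn m hA (by
      have : (m + 2) * (m + 2 + 1) = m * (m + 1) + 4 * m + 6 := by ring
      omega)
    have key : ∀ v, ∃ w ∈ A, G.dist w v ≤ 1 := by
      intro v
      by_cases hv : v = x
      · exact ⟨x, hA.1, by simp [hv]⟩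
      · obtain ⟨w, hw, hadj, -⟩ := hconn.exists_adj_two_le_degree hx hv
        exact ⟨w, by simpa [hAdef] using hw, (dist_eq_one_iff_adj.2 hadj).le⟩
    -- Index `0` has radius `m + 1` and index `m - i` has radius `i + 1`: one more than needed on
    -- `A`.
    refine hconn.burningNumber_le_of_cover (fun i => if i = 0 then z else c (m - i)) fun v => ?_
    obtain ⟨w, hw, hwv⟩ := key v
    have htri : ∀ y, G.dist y v ≤ G.dist y w + G.dist w v := fun y => hconn.dist_triangle
    obtain ⟨i, hi, h⟩ | h := hcz w hw
    · refine ⟨m - i, by omega, ?_⟩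
      have h1 : m - (m - i) = i := by omega
      simp only [h1, if_neg (show m - i ≠ 0 by omega)]
      have := htri (c i)
      omega
    · refine ⟨0, by omega, ?_⟩
      have := htri z
      simp only [if_true]
      omega
  -- Without non-leaves there are at most two vertices, and one ball suffices.
  · push Not at hx
    have hle : ∑ v, G.degree v ≤ ∑ _v : V, 1 :=
      Finset.sum_le_sum fun v _ => Nat.lt_succ_iff.1 (hx v)
    rw [Finset.sum_const, Finset.card_univ, smul_eq_mul, mul_one] at hle
    have hsum := hG.sum_degree
    have hVk : Fintype.card V ≤ k := by
      have : 0 < Fintype.card V := Fintype.card_pos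
      by_contra h
      have : k ≤ 1 := by omega
      interval_cases k <;> omega
    obtain ⟨x⟩ := hne
    refine hconn.burningNumber_le_of_cover (fun _ => x) fun v => ⟨0, ?_, ?_⟩
    · have : 0 < Fintype.card V := Fintype.card_pos_iff.2 ⟨x⟩
      omega
    · obtain ⟨q, hq⟩ := (hconn x v).exists_isPath
      have h1 := hq.length_lt
      have h2 := dist_le q
      omega

end Trees

end SimpleGraph

/-! ### Arithmetic of the closed-form bound -/

/-- If `K` is the ceiling of the bound in terms of `N`, then `N < K (K + 1)`. -/
theorem exists_ceil_eq_and_lt_mul_succ {N : ℕ} (hN : 0 < N) :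
    ∃ k : ℕ, ⌈((N : ℝ) - ⌈Real.sqrt ((N : ℝ) + 0.25) - 1.5⌉) ^ (1 / 2 : ℝ)⌉ = (k : ℤ) ∧
      N + 1 ≤ k * (k + 1) := by
  set t : ℤ := ⌈Real.sqrt ((N : ℝ) + 0.25) - 1.5⌉ with ht
  have hN1 : (1 : ℝ) ≤ N := by exact_mod_cast hN
  have hs0 : 0 ≤ Real.sqrt ((N : ℝ) + 0.25) := Real.sqrt_nonneg _
  have hs2 : Real.sqrt ((N : ℝ) + 0.25) ^ 2 = N + 0.25 := Real.sq_sqrt (by linarith)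
  set s := Real.sqrt ((N : ℝ) + 0.25)
  have ht1 : (t : ℝ) < s - 1.5 + 1 := Int.ceil_lt_add_one _
  have ht0 : 0 ≤ t := by
    have h : (-1 : ℝ) < s - 1.5 := by nlinarith
    have : (-1 : ℤ) < t := by
      rw [ht, Int.lt_ceil]
      exact_mod_cast h
    omega
  have ht0' : (0 : ℝ) ≤ t := by exact_mod_cast ht0
  -- Square `t + 1/2 < s`.
  have htN : (t : ℝ) ^ 2 + t < N := by nlinarith
  have hpos : 0 < (N : ℝ) - t := by nlinarith
  rw [← Real.sqrt_eq_rpow]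
  have hK0 : 0 < ⌈Real.sqrt ((N : ℝ) - t)⌉ := Int.ceil_pos.2 (Real.sqrt_pos.2 hpos)
  have hK := Int.le_ceil (Real.sqrt ((N : ℝ) - t))
  obtain ⟨k, hk⟩ := Int.eq_ofNat_of_zero_le hK0.le
  refine ⟨k, hk, ?_⟩
  rw [hk] at hK
  have hNk : (N : ℝ) - t ≤ (k : ℝ) ^ 2 := (Real.sqrt_le_left (by positivity)).1 (by
    exact_mod_cast hK)
  have h1 : (N : ℤ) - t ≤ (k : ℤ) ^ 2 := by exact_mod_cast hNk
  have h2 : t ^ 2 + t < N := by exact_mod_cast htN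
  -- `t ^ 2 < N - t ≤ k ^ 2`; then `N ≤ k ^ 2 + t < k ^ 2 + k`.
  have h3 : t + 1 ≤ k := by
    by_contra h
    nlinarith
  zify
  nlinarith

theorem mainTheorem1 {V : Type*} [Fintype V] (T : SimpleGraph V) [DecidableRel T.Adj]
    (hT : T.IsTree) (n n₂ : ℕ) (hn : n = Fintype.card V)
    (hn₂ : n₂ = (Finset.univ.filter (fun v : V => T.degree v = 2)).card) :
    (T.burningNumber : ℤ) ≤
      ⌈((n : ℝ) + n₂ - ⌈Real.sqrt ((n : ℝ) + n₂ + 0.25) - 1.5⌉) ^ (1 / 2 : ℝ)⌉ := by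
  have hne := hT.connected.nonempty
  have hpos : 0 < Fintype.card V := Fintype.card_pos
  obtain ⟨k, hk, hN⟩ := exists_ceil_eq_and_lt_mul_succ (N := n + n₂) (by omega)
  rw [Nat.cast_add] at hk
  rw [hk]
  exact_mod_cast hT.burningNumber_le (by omega)
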